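/- **Setting.** Fix a term algebra: data values, interpreted operators, a set of values that count as true, and action labels. Expressions are built from values, variables and operators; action terms are $a(e_1,\dots,e_n)$, and the *signature* of an action term is its label with its arity. Equations between expressions or actions, and predicates, are interpreted under valuations of the variables; predicates are taken modulo logical equivalence. A *pLTS* $\langle S,s_0,V,\to\rangle$ has states $S$, an initial state $s_0$, variables $V$ (which may be given initial values) and transitions $s\xrightarrow{\langle\alpha,g,(x_k:=e_k)_k\rangle}s'$, where $\alpha$ is an action whose parameters are expressions or input variables $?x$ (an input variable occurring nowhere else in $\alpha$), $g$ is a guard and $x_k\in V$; all variables of $\alpha$ other than its input variables are in $V$, those of $g$ are in $V$ or occur in $\alpha$, and those of the $e_k$ are in $V$ or are input variables of $\alpha$. A *pNet* is a pLTS or a node $\langle (P_i)_{i\in I},(\mathrm{Sort}_j)_{j\in J},\overline{SV}\rangle$ with sub-pNets $P_i$, holes $J$ with sorts (sets of action signatures), and a set of synchronisation vectors $(\alpha_l)_{l\in M}\to\alpha'[g]$, $M\subseteq I\cup J$, where the signature of $\alpha_l$ is in $\mathrm{Sort}(P_l)$ or $\mathrm{Sort}_l$ and the variables of $\alpha'$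 and of the guard $g$ occur in the $\alpha_l$. Here $I\cap J=\emptyset\ne I\cup J$; the sets of variables of distinct $P_i$ are disjoint; the sets of all holes of the $P_i$ are disjoint from $J$ and from each other. The sort of a pLTS is the set of signatures of its transition actions; the sort of a node is the set of signatures of the global actions $\alpha'$ of its vectors. Filling a hole $j_0\in J$ gives $P[Q]_{j_0}=\langle (P_i)_{i\in I}\uplus\{j_0\mapsto Q\},(\mathrm{Sort}_j)_{j\in J\setminus\{j_0\}},\overline{SV}\rangle$. **Semantics.** An *open transition* $s\xrightarrow{\alpha}s'$ carries actions $(\beta_j)_{j\in J'}$ of some holes, with the signature of $\beta_j$ in the sort of $j$, a predicate $\mathrm{Pred}$, and simultaneous assignments $\mathrm{Post}$ to variables of the automaton. The *open automaton* of a pNet $P$ has all the holes of $P$ with their sorts, the variables of the pLTSs of $P$, and the tuples of states of these pLTSs as states. Its open transitions are the least family that is generated by the following two rules at every level of $P$ and closed under conjoining any predicate and under substituting expressions for variables that are not variables of the pNet. (1) A transition of a pLTS gives the open transition with no hole, with predicate $g$, action $\alpha$ without input markers, and its assignments. (2) For a node, a synchronisation vector with index set $M$, open transitions of the $P_i$ for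 $i\in M\cap I$ with actions $\gamma_i$, and actions $\beta_j$ with signature in $\mathrm{Sort}_j$ for $j\in M\cap J$, give an open transition with any action $\gamma$, the union of the hole actions, the union of the assignments, the states of the sub-pNets outside $M$ unchanged, and as predicate the conjunction of the predicates of the sub-pNets, $\gamma_i=\alpha_i$, $\beta_j=\alpha_j$, $\gamma=\alpha'$ and $g$, the variables of the vector being local to it (renamed apart). **Bisimulation.** A *strong FH-bisimulation* between two open automata with the same holes of the same sorts and disjoint sets of variables assigns to each pair of states $(s,t)$ a predicate $\mathrm{Pred}_{s,t}$ over the variables of both automata, such that for every open transition $s\xrightarrow{\alpha}s'$ of the first, with hole actions $(\beta_j)_{j\in J'}$, predicate $\mathrm{Pred}$ and assignments $\mathrm{Post}$, and for every state $t$ of the second, there is a family of open transitions $t\xrightarrow{\alpha_x}t_x$ of the second, with hole actions $(\beta_{jx})_{j\in J'}$, predicates $\mathrm{Pred}_x$ and assignments $\mathrm{Post}_x$, such that $$\mathrm{Pred}_{s,t}\wedge\mathrm{Pred}\implies\bigvee_x\Bigl(\forall j\in J'.\,\beta_j=\beta_{jx}\;\wedge\;\mathrm{Pred}_x\;\wedge\;\alpha=\alpha_x\;\wedge\;\mathrm{Pred}_{s',t_x}\{\mathrm{Post}\uplus\mathrm{Post}_x\}\Bigr),$$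 and symmetrically. Two pNets are *strongly FH-bisimilar* if, after renaming their variables apart, there is a strong FH-bisimulation between their open automata whose predicate at the pair of initial states is satisfiable by a valuation that respects the given initial values. **Theorem (Congruence).** Let $P=\langle (P_i)_{i\in I},(\mathrm{Sort}_j)_{j\in J},\overline{SV}\rangle$ be an open pNet and $j_0\in J$ a hole. Let $Q$ and $Q'$ be strongly FH-bisimilar pNets with $\mathrm{Sort}(Q)=\mathrm{Sort}(Q')=\mathrm{Sort}_{j_0}$, whose variables are disjoint from those of $P$ and whose holes are disjoint from the holes of $P$ other than $j_0$ (so that $P[Q]_{j_0}$ and $P[Q']_{j_0}$ are pNets). Then $P[Q]_{j_0}$ and $P[Q']_{j_0}$ are strongly FH-bisimilar. -/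

import Mathlib

universe u v w z

/-! ### Term algebra -/

/-- A data and action signature with its interpretation: data values, data operators (each with an
arity and an interpretation on values), action labels, and the set of values that count as true. -/
structure TermAlgebra where
  Val : Type u
  Op : Type u
  arity : Op → ℕ
  interp : (o : Op) → (Fin (arity o) → Val) → Val
  Label : Type u
  truth : Set Val

/-- Expressions over the variables `X`. -/
inductive Expr (𝔄 : TermAlgebra.{u}) (X : Type v) : Type (max u v)
  | val (a : 𝔄.Val) : Expr 𝔄 X
  | var (x : X) : Expr 𝔄 X
  | op (o : 𝔄.Op) (args : Fin (𝔄.arity o) → Expr 𝔄 X) : Expr 𝔄 X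

namespace Expr

variable {𝔄 : TermAlgebra.{u}} {X : Type v} {Y : Type w} {Z : Type z}

/-- The variables of an expression. -/
def vars : Expr 𝔄 X → Set X
  | val _ => ∅
  | var x => {x}
  | op _ args => ⋃ i, (args i).vars

/-- Parallel substitution of expressions for variables. -/
def subst (σ : X → Expr 𝔄 Y) : Expr 𝔄 X → Expr 𝔄 Y
  | val a => val a
  | var x => σ x
  | op o args => op o (fun i => (args i).subst σ)

/-- Renaming of variables. -/
def rename (ι : X → Y) (e : Expr 𝔄 X) : Expr 𝔄 Y := e.subst (fun x => var (ι x))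

/-- The value of an expression under a valuation of the variables. -/
def eval (ρ : X → 𝔄.Val) : Expr 𝔄 X → 𝔄.Val
  | val a => a
  | var x => ρ x
  | op o args => 𝔄.interp o (fun i => (args i).eval ρ)

/-- The formula "`e` is true" under a valuation. -/
def Holds (e : Expr 𝔄 X) (ρ : X → 𝔄.Val) : Prop := e.eval ρ ∈ 𝔄.truth

theorem subst_subst (σ : X → Expr 𝔄 Y) (τ : Y → Expr 𝔄 Z) (e : Expr 𝔄 X) :
    (e.subst σ).subst τ = e.subst (fun x => (σ x).subst τ) := by
  induction e with
  | val a => rfl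
  | var x => rfl
  | op o args ih => simp only [subst, ih]

theorem eval_subst (σ : X → Expr 𝔄 Y) (ρ : Y → 𝔄.Val) (e : Expr 𝔄 X) :
    (e.subst σ).eval ρ = e.eval (fun x => (σ x).eval ρ) := by
  induction e with
  | val a => rfl
  | var x => rfl
  | op o args ih => simp only [subst, eval, ih]

end Expr

/-- Action signatures: an action label with an arity. -/
abbrev ActSig (𝔄 : TermAlgebra.{u}) : Type u := 𝔄.Label × ℕ

/-- Action terms `a(e₁, …, eₙ)`, without input variables. -/
structure Act (𝔄 : TermAlgebra.{u}) (X : Type v) where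
  label : 𝔄.Label
  args : List (Expr 𝔄 X)

namespace Act

variable {𝔄 : TermAlgebra.{u}} {X : Type v} {Y : Type w} {Z : Type z}

/-- The label and the arity of an action. -/
def sig (α : Act 𝔄 X) : ActSig 𝔄 := (α.label, α.args.length)

def vars (α : Act 𝔄 X) : Set X := {x | ∃ e ∈ α.args, x ∈ e.vars}

def subst (σ : X → Expr 𝔄 Y) (α : Act 𝔄 X) : Act 𝔄 Y := ⟨α.label, α.args.map (Expr.subst σ)⟩

def rename (ι : X → Y) (α : Act 𝔄 X) : Act 𝔄 Y := α.subst (fun x => Expr.var (ι x))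

/-- The ground action denoted under a valuation; `α.eval ρ = α'.eval ρ` is the meaning of the
formula `α = α'` under `ρ`. -/
def eval (ρ : X → 𝔄.Val) (α : Act 𝔄 X) : 𝔄.Label × List 𝔄.Val := (α.label, α.args.map (Expr.eval ρ))

theorem sig_subst (σ : X → Expr 𝔄 Y) (α : Act 𝔄 X) : (α.subst σ).sig = α.sig := by
  simp [sig, subst]

theorem subst_subst (σ : X → Expr 𝔄 Y) (τ : Y → Expr 𝔄 Z) (α : Act 𝔄 X) :
    (α.subst σ).subst τ = α.subst (fun x => (σ x).subst τ) := by
  simp [subst, Expr.subst_subst]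

end Act

/-- Parameters of the actions of a pLTS: input variables `?x` or expressions. -/
inductive Param (𝔄 : TermAlgebra.{u}) (X : Type v) : Type (max u v)
  | inp (x : X) : Param 𝔄 X
  | exp (e : Expr 𝔄 X) : Param 𝔄 X

/-- The parameter with its input marker, if any, removed. -/
def Param.toExpr {𝔄 : TermAlgebra.{u}} {X : Type v} : Param 𝔄 X → Expr 𝔄 X
  | .inp x => .var x
  | .exp e => e

/-- Actions of pLTSs; an input variable appears nowhere else in the action. -/
structure InAct (𝔄 : TermAlgebra.{u}) (X : Type v) where
  label : 𝔄.Label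
  params : List (Param 𝔄 X)
  inp_unique : ∀ (i j : Fin params.length) (x : X), i ≠ j → params.get i = Param.inp x →
    x ∉ (params.get j).toExpr.vars

namespace InAct

variable {𝔄 : TermAlgebra.{u}} {X : Type v}

/-- The input variables. -/
def iv (α : InAct 𝔄 X) : Set X := {x | Param.inp x ∈ α.params}

/-- Removal of the input markers. -/
def toAct (α : InAct 𝔄 X) : Act 𝔄 X := ⟨α.label, α.params.map Param.toExpr⟩

def vars (α : InAct 𝔄 X) : Set X := α.toAct.vars

end InAct

/-! ### pNets -/

/-- Parameterised labelled transition systems. `tr s α g asg s'` is a transition from `s` to `s'`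
with action `α`, guard `g` and parallel assignments `x := e` for `asg x = some e`.
A variable may be given an initial value by `init`. -/
structure PLTS (𝔄 : TermAlgebra.{u}) (X : Type v) : Type (max u v (z + 1)) where
  S : Type z
  s₀ : S
  V : Set X
  init : X → Option 𝔄.Val
  tr : S → InAct 𝔄 X → Expr 𝔄 X → (X → Option (Expr 𝔄 X)) → S → Prop
  act_vars : ∀ {s α g asg s'}, tr s α g asg s' → α.vars \ α.iv ⊆ V
  guard_vars : ∀ {s α g asg s'}, tr s α g asg s' → g.vars ⊆ V ∪ α.vars
  asg_vars : ∀ {s α g asg s'}, tr s α g asg s' →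
    ∀ x e, asg x = some e → x ∈ V ∧ e.vars ⊆ V ∪ α.iv

/-- Synchronisation vectors: actions `act l` of the involved sub-pNets and holes `l`
(those with `act l ≠ none`), a global action and a guard. -/
structure SyncVec (𝔄 : TermAlgebra.{u}) (X : Type v) (Idx : Type w) where
  act : Idx → Option (Act 𝔄 X)
  glob : Act 𝔄 X
  guard : Expr 𝔄 X
  glob_vars : glob.vars ⊆ {x | ∃ l a, act l = some a ∧ x ∈ a.vars}
  guard_vars : guard.vars ⊆ {x | ∃ l a, act l = some a ∧ x ∈ a.vars}

/-- pNets: a pLTS, or a node with sub-pNets indexed by `I`, holes `J` with their sorts, and a set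
of synchronisation vectors. The side conditions are in `PNet.WF`. -/
inductive PNet (𝔄 : TermAlgebra.{u}) (X : Type v) (Idx : Type w) : Type (max u v w (z + 1))
  | lts (p : PLTS.{u, v, z} 𝔄 X) : PNet 𝔄 X Idx
  | node (I J : Set Idx) (sub : I → PNet 𝔄 X Idx) (sort : J → Set (ActSig 𝔄))
      (SV : Set (SyncVec 𝔄 X Idx)) : PNet 𝔄 X Idx

namespace PNet

variable {𝔄 : TermAlgebra.{u}} {X : Type v} {Idx : Type w}

/-- The sort of a pNet: the signatures of the actions it can expose. -/
def outSort : PNet.{u, v, w, z} 𝔄 X Idx → Set (ActSig 𝔄)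
  | lts p => {a | ∃ s α g asg s', p.tr s α g asg s' ∧ a = α.toAct.sig}
  | node _ _ _ _ SV => {a | ∃ sv ∈ SV, a = sv.glob.sig}

/-- The variables of all the pLTSs of a pNet. -/
def vars : PNet.{u, v, w, z} 𝔄 X Idx → Set X
  | lts p => p.V
  | node _ _ sub _ _ => ⋃ i, (sub i).vars

/-- All the holes of a pNet. -/
def holes : PNet.{u, v, w, z} 𝔄 X Idx → Set Idx
  | lts _ => ∅
  | node _ J sub _ _ => J ∪ ⋃ i, (sub i).holes

/-- The sorts of all the holes of a pNet. -/
def holeSort : PNet.{u, v, w, z} 𝔄 X Idx → Idx → Set (ActSig 𝔄)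
  | lts _ => fun _ => ∅
  | node _ J sub sort _ => fun j =>
      {a | (∃ h : j ∈ J, a ∈ sort ⟨j, h⟩) ∨ ∃ i, a ∈ (sub i).holeSort j}

/-- The indices of the leaves of a pNet (a pLTS is its own single leaf). -/
def Leaves : PNet.{u, v, w, z} 𝔄 X Idx → Type w
  | lts _ => PUnit
  | node _ _ sub _ _ => Σ i, (sub i).Leaves

/-- The pLTS at a leaf. -/
def leaf : (P : PNet.{u, v, w, z} 𝔄 X Idx) → P.Leaves → PLTS.{u, v, z} 𝔄 X
  | lts p => fun _ => p
  | node _ _ sub _ _ => fun l => (sub l.1).leaf l.2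

/-- The states of a pNet: tuples of states of its leaves. -/
def State (P : PNet.{u, v, w, z} 𝔄 X Idx) : Type (max w z) := (l : P.Leaves) → (P.leaf l).S

/-- The initial state. -/
def initState (P : PNet.{u, v, w, z} 𝔄 X Idx) : P.State := fun l => (P.leaf l).s₀

/-- The part of a state that concerns one sub-pNet. -/
def proj {I J : Set Idx} {sub : I → PNet.{u, v, w, z} 𝔄 X Idx} {sort : J → Set (ActSig 𝔄)}
    {SV : Set (SyncVec 𝔄 X Idx)} (s : (node I J sub sort SV).State) (i : I) : (sub i).State :=
  fun l => s ⟨i, l⟩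

/-- The side conditions in the definition of pNets. -/
def WF : PNet.{u, v, w, z} 𝔄 X Idx → Prop
  | lts _ => True
  | node I J sub sort SV =>
      (∀ i, (sub i).WF) ∧ Disjoint I J ∧ (I ∪ J).Nonempty ∧
      (∀ i i', i ≠ i' → Disjoint (sub i).vars (sub i').vars) ∧
      (∀ i, Disjoint (sub i).holes J) ∧
      (∀ i i', i ≠ i' → Disjoint (sub i).holes (sub i').holes) ∧
      ∀ sv ∈ SV, ∀ l a, sv.act l = some a →
        (∃ h : l ∈ I, a.sig ∈ (sub ⟨l, h⟩).outSort) ∨ (∃ h : l ∈ J, a.sig ∈ sort ⟨l, h⟩)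

open Classical in
/-- `P.fill j₀ Q` is the composition `P[Q]` at the hole `j₀` of the node `P`
(only meaningful when `j₀` is among the holes declared by the node). -/
noncomputable def fill : PNet.{u, v, w, z} 𝔄 X Idx → Idx → PNet.{u, v, w, z} 𝔄 X Idx →
    PNet.{u, v, w, z} 𝔄 X Idx
  | lts p, _, _ => lts p
  | node I J sub sort SV, j₀, Q =>
      node (insert j₀ I) (J \ {j₀}) (fun i => if h : i.1 ∈ I then sub ⟨i.1, h⟩ else Q)
        (fun j => sort ⟨j.1, j.2.1⟩) SV

end PNet

/-! ### Open automata -/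

/-- Open transitions with states in `S`: `hole j = some β` means that the hole `j` is involved with
the action `β`; predicates are taken modulo logical equivalence, as properties of valuations;
`post` is the set of the assignments `x ← e` with `post x = some e`. -/
structure OpenTransition (𝔄 : TermAlgebra.{u}) (Idx : Type w) (Y : Type v) (S : Type z) where
  src : S
  tgt : S
  hole : Idx → Option (Act 𝔄 Y)
  act : Act 𝔄 Y
  pred : (Y → 𝔄.Val) → Prop
  post : Y → Option (Expr 𝔄 Y)

namespace OpenTransition

variable {𝔄 : TermAlgebra.{u}} {Idx : Type w} {Y : Type v} {S : Type z}

/-- The refinement of an open transition by a substitution `σ` and an additional predicate `φ`. -/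
def refine (t : OpenTransition 𝔄 Idx Y S) (σ : Y → Expr 𝔄 Y) (φ : (Y → 𝔄.Val) → Prop) :
    OpenTransition 𝔄 Idx Y S where
  src := t.src
  tgt := t.tgt
  hole := fun j => (t.hole j).map (Act.subst σ)
  act := t.act.subst σ
  pred := fun ρ => t.pred (fun y => (σ y).eval ρ) ∧ φ ρ
  post := fun y => (t.post y).map (Expr.subst σ)

/-- All refinements of the transitions in `T` by substitutions that leave the variables in `V`
alone. -/
def saturate (V : Set Y) (T : Set (OpenTransition 𝔄 Idx Y S)) : Set (OpenTransition 𝔄 Idx Y S) :=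
  {t | ∃ t₀ ∈ T, ∃ σ φ, (∀ y ∈ V, σ y = Expr.var y) ∧ t = t₀.refine σ φ}

theorem saturate_closed (V : Set Y) (T : Set (OpenTransition 𝔄 Idx Y S)) :
    ∀ t ∈ saturate V T, ∀ σ φ, (∀ y ∈ V, σ y = Expr.var y) → t.refine σ φ ∈ saturate V T := by
  rintro _ ⟨t₀, ht₀, τ, ψ, hτ, rfl⟩ σ φ hσ
  refine ⟨t₀, ht₀, fun y => (τ y).subst σ, fun ρ => ψ (fun y => (σ y).eval ρ) ∧ φ ρ, ?_, ?_⟩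
  · intro y hy
    simp [hτ y hy, Expr.subst, hσ y hy]
  · simp only [refine, Option.map_map, Act.subst_subst, Expr.eval_subst]
    congr 1
    · funext j
      congr 1
      funext a
      simp [Act.subst_subst]
    · funext ρ
      simp [and_assoc]
    · funext y
      congr 1
      funext e
      simp [Expr.subst_subst]

end OpenTransition

/-- Open automata over the variable names `Y`. `init y a` says that `a` is the initial value of
`y`. -/
structure OpenAutomaton (𝔄 : TermAlgebra.{u}) (Idx : Type w) (Y : Type v) where
  J : Set Idx
  sort : Idx → Set (ActSig 𝔄)
  S : Type z
  s₀ : S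
  V : Set Y
  init : Y → 𝔄.Val → Prop
  T : Set (OpenTransition 𝔄 Idx Y S)
  hole_mem : ∀ t ∈ T, ∀ j β, t.hole j = some β → j ∈ J ∧ β.sig ∈ sort j
  post_mem : ∀ t ∈ T, ∀ y e, t.post y = some e → y ∈ V
  closed : ∀ t ∈ T, ∀ σ φ, (∀ y ∈ V, σ y = Expr.var y) → t.refine σ φ ∈ T

namespace OpenAutomaton

variable {𝔄 : TermAlgebra.{u}} {Idx : Type w} {Y : Type v}

/-- The valuation after the simultaneous application of two sets of assignments (to disjoint sets
of variables). -/
def update (p q : Y → Option (Expr 𝔄 Y)) (ρ : Y → 𝔄.Val) : Y → 𝔄.Val :=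
  fun y => (((p y).or (q y)).getD (Expr.var y)).eval ρ

/-- One half of a strong FH-bisimulation: every open transition `t` of `A` from `s` is covered, at
every state `s'` of `B`, by a family `F` of open transitions of `B` from `s'`. -/
def FHSimulation (A B : OpenAutomaton.{u, v, w, z} 𝔄 Idx Y)
    (R : A.S → B.S → (Y → 𝔄.Val) → Prop) : Prop :=
  ∀ (s : A.S) (s' : B.S), ∀ t ∈ A.T, t.src = s →
    ∃ F ⊆ B.T, (∀ t' ∈ F, t'.src = s' ∧ ∀ j, (t'.hole j).isSome ↔ (t.hole j).isSome) ∧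
      ∀ ρ : Y → 𝔄.Val, R s s' ρ → t.pred ρ →
        ∃ t' ∈ F, (∀ j β β', t.hole j = some β → t'.hole j = some β' → β.eval ρ = β'.eval ρ) ∧
          t'.pred ρ ∧ t.act.eval ρ = t'.act.eval ρ ∧
          R t.tgt t'.tgt (update t.post t'.post ρ)

/-- Strong FH-bisimulations between open automata with the same holes of the same sorts and
disjoint sets of variables. `R s s'` is the predicate, over the variables of both automata, under
which the states `s` and `s'` are related. -/
structure FHBisimulation (A B : OpenAutomaton.{u, v, w, z} 𝔄 Idx Y)
    (R : A.S → B.S → (Y → 𝔄.Val) → Prop) : Prop where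
  same_holes : A.J = B.J
  same_sorts : ∀ j ∈ A.J, A.sort j = B.sort j
  disjoint_vars : Disjoint A.V B.V
  over_vars : ∀ s s', DependsOn (R s s') (A.V ∪ B.V)
  forth : FHSimulation A B R
  back : FHSimulation B A (fun s' s => R s s')

end OpenAutomaton

/-! ### Semantics of pNets -/

namespace PNet

variable {𝔄 : TermAlgebra.{u}} {X Y : Type v} {Idx : Type w}

/-- The rule for pLTSs, the variables being renamed along `ι`. -/
def ruleLTS (ι : X → Y) (p : PLTS.{u, v, z} 𝔄 X) :
    Set (OpenTransition 𝔄 Idx Y (lts p : PNet.{u, v, w, z} 𝔄 X Idx).State) :=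
  {t | ∃ s α g asg s', p.tr s α g asg s' ∧
    t.src = (fun _ => s) ∧ t.tgt = (fun _ => s') ∧
    (∀ j, t.hole j = none) ∧
    t.act = α.toAct.rename ι ∧
    t.pred = (g.rename ι).Holds ∧
    ∀ y e, t.post y = some e ↔ ∃ x e₀, ι x = y ∧ asg x = some e₀ ∧ e₀.rename ι = e}

/-- The rule for nodes. One synchronisation vector `sv` is used, each involved sub-pNet `i` performs
the open transition `o i` and each involved hole `j` performs `b j`. The variables of `sv` are
local to `sv`: they are instantiated by `θ`. (Fresh names for the variables of `sv`, `b` and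
`t.act`, followed by saturation, give the same open transitions.) -/
def ruleNode {I J : Set Idx} {sub : I → PNet.{u, v, w, z} 𝔄 X Idx} {sort : J → Set (ActSig 𝔄)}
    {SV : Set (SyncVec 𝔄 X Idx)}
    (T : (i : I) → Set (OpenTransition 𝔄 Idx Y (sub i).State)) :
    Set (OpenTransition 𝔄 Idx Y (node I J sub sort SV).State) :=
  {t | ∃ sv ∈ SV, ∃ (θ : X → Expr 𝔄 Y) (o : (i : I) → OpenTransition 𝔄 Idx Y (sub i).State)
      (b : J → Act 𝔄 Y),
    (∀ i : I, sv.act i ≠ none →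
      o i ∈ T i ∧ (o i).src = proj t.src i ∧ (o i).tgt = proj t.tgt i) ∧
    (∀ i : I, sv.act i = none → proj t.tgt i = proj t.src i) ∧
    (∀ j : J, sv.act j ≠ none → (b j).sig ∈ sort j) ∧
    (∀ j β, t.hole j = some β ↔
      (∃ h : j ∈ J, sv.act j ≠ none ∧ b ⟨j, h⟩ = β) ∨
      (∃ i : I, sv.act i ≠ none ∧ (o i).hole j = some β)) ∧
    (∀ ρ, t.pred ρ ↔
      (∀ i : I, sv.act i ≠ none → (o i).pred ρ) ∧
      (∀ (i : I) (a : Act 𝔄 X), sv.act i = some a → (o i).act.eval ρ = (a.subst θ).eval ρ) ∧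
      (∀ (j : J) (a : Act 𝔄 X), sv.act j = some a → (b j).eval ρ = (a.subst θ).eval ρ) ∧
      t.act.eval ρ = (sv.glob.subst θ).eval ρ ∧
      (sv.guard.subst θ).Holds ρ) ∧
    ∀ y e, t.post y = some e ↔ ∃ i : I, sv.act i ≠ none ∧ (o i).post y = some e}

/-- The open transitions of a pNet. -/
def trans (ι : X → Y) :
    (P : PNet.{u, v, w, z} 𝔄 X Idx) → Set (OpenTransition 𝔄 Idx Y P.State)
  | lts p => OpenTransition.saturate (ι '' p.V) (ruleLTS ι p)
  | node I J sub sort SV =>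
      OpenTransition.saturate (ι '' (node I J sub sort SV).vars)
        (ruleNode (fun i => trans ι (sub i)))

theorem trans_hole (ι : X → Y) (P : PNet.{u, v, w, z} 𝔄 X Idx) :
    ∀ t ∈ trans ι P, ∀ j β, t.hole j = some β → j ∈ P.holes ∧ β.sig ∈ P.holeSort j := by
  induction P with
  | lts p =>
    rintro _ ⟨t₀, ⟨s, α, g, asg, s', -, -, -, h, -⟩, σ, φ, -, rfl⟩ j β hj
    simp [OpenTransition.refine, h] at hj
  | node I J sub sort SV ih =>
    rintro _ ⟨t₀, ⟨sv, -, θ, o, b, ho, -, hb, hh, -⟩, σ, φ, -, rfl⟩ j β hj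
    obtain ⟨β₀, h₀, rfl⟩ := Option.map_eq_some_iff.1 hj
    rw [Act.sig_subst]
    rcases (hh j β₀).1 h₀ with ⟨h, hv, rfl⟩ | ⟨i, hi, h⟩
    · exact ⟨Or.inl h, Or.inl ⟨h, hb ⟨j, h⟩ hv⟩⟩
    · obtain ⟨h₁, h₂⟩ := ih i _ (ho i hi).1 j β₀ h
      exact ⟨Or.inr (Set.mem_iUnion.2 ⟨i, h₁⟩), Or.inr ⟨i, h₂⟩⟩

theorem trans_post (ι : X → Y) (P : PNet.{u, v, w, z} 𝔄 X Idx) :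
    ∀ t ∈ trans ι P, ∀ y e, t.post y = some e → y ∈ ι '' P.vars := by
  induction P with
  | lts p =>
    rintro _ ⟨t₀, ⟨s, α, g, asg, s', htr, -, -, -, -, -, h⟩, σ, φ, -, rfl⟩ y e hy
    obtain ⟨e₀, h₀, rfl⟩ := Option.map_eq_some_iff.1 hy
    obtain ⟨x, e₁, rfl, hx, -⟩ := (h y e₀).1 h₀
    exact ⟨x, (p.asg_vars htr x e₁ hx).1, rfl⟩
  | node I J sub sort SV ih =>
    rintro _ ⟨t₀, ⟨sv, -, θ, o, b, ho, -, -, -, -, h⟩, σ, φ, -, rfl⟩ y e hy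
    obtain ⟨e₀, h₀, rfl⟩ := Option.map_eq_some_iff.1 hy
    obtain ⟨i, hi, h₁⟩ := (h y e₀).1 h₀
    obtain ⟨x, hx, rfl⟩ := ih i _ (ho i hi).1 y e₀ h₁
    exact ⟨x, Set.mem_iUnion.2 ⟨i, hx⟩, rfl⟩

theorem trans_closed (ι : X → Y) (P : PNet.{u, v, w, z} 𝔄 X Idx) :
    ∀ t ∈ trans ι P, ∀ σ φ, (∀ y ∈ ι '' P.vars, σ y = Expr.var y) → t.refine σ φ ∈ trans ι P := by
  cases P with
  | lts p => exact OpenTransition.saturate_closed _ _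
  | node I J sub sort SV => exact OpenTransition.saturate_closed _ _

/-- The open automaton of a pNet whose variables are renamed along `ι` (for `ι = id`, the open
automaton of the pNet itself). -/
def automaton (ι : X → Y) (P : PNet.{u, v, w, z} 𝔄 X Idx) :
    OpenAutomaton.{u, v, w, max w z} 𝔄 Idx Y where
  J := P.holes
  sort := P.holeSort
  S := P.State
  s₀ := P.initState
  V := ι '' P.vars
  init := fun y a => ∃ l, ∃ x ∈ (P.leaf l).V, ι x = y ∧ (P.leaf l).init x = some a
  T := trans ι P
  hole_mem := trans_hole ι P
  post_mem := trans_post ι P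
  closed := trans_closed ι P

/-- Strong FH-bisimilarity of pNets: some FH-bisimulation between their open automata relates the
initial states, i.e. the predicate of the initial states is satisfiable (by a valuation that
respects the given initial values). FH-bisimulations compare automata with disjoint sets of
variables; so the variables of the two pNets are first renamed apart, in `X ⊕ X`. -/
def FHBisimilar (P Q : PNet.{u, v, w, z} 𝔄 X Idx) : Prop :=
  ∃ R : P.State → Q.State → (X ⊕ X → 𝔄.Val) → Prop,
    OpenAutomaton.FHBisimulation (P.automaton Sum.inl) (Q.automaton Sum.inr) R ∧
    ∃ ρ : X ⊕ X → 𝔄.Val,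
      (∀ y a, (P.automaton Sum.inl).init y a → ρ y = a) ∧
      (∀ y a, (Q.automaton Sum.inr).init y a → ρ y = a) ∧
      R P.initState Q.initState ρ

end PNet

theorem exists_option_fun {α : Type*} {β : Type*} (r : α → β → Prop)
    (h : ∀ a b b', r a b → r a b' → b = b') :
    ∃ f : α → Option β, ∀ a b, f a = some b ↔ r a b := by
  classical
  refine ⟨fun a => if h : ∃ b, r a b then some h.choose else none, fun a b => ?_⟩
  by_cases hb : ∃ b, r a b
  · simp only [hb, dif_pos, Option.some.injEq]
    exact ⟨fun e => e ▸ hb.choose_spec, fun hr => h _ _ _ hb.choose_spec hr⟩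
  · simp only [hb, dif_neg, not_false_eq_true, reduceCtorEq, false_iff]
    exact fun hr => hb ⟨b, hr⟩

theorem Expr.subst_var {𝔄 : TermAlgebra.{u}} {X : Type v} (e : Expr 𝔄 X) :
    e.subst Expr.var = e := by
  induction e with
  | val a => rfl
  | var x => rfl
  | op o args ih => simp only [subst, ih]

theorem Act.subst_var {𝔄 : TermAlgebra.{u}} {X : Type v} (α : Act 𝔄 X) :
    α.subst Expr.var = α := by
  simp [subst, funext Expr.subst_var]

theorem Act.eval_subst {𝔄 : TermAlgebra.{u}} {X : Type v} {Y : Type w} (σ : X → Expr 𝔄 Y)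
    (ρ : Y → 𝔄.Val) (α : Act 𝔄 X) :
    (α.subst σ).eval ρ = α.eval (fun x => (σ x).eval ρ) := by
  simp only [Act.eval, Act.subst, List.map_map, Prod.mk.injEq, true_and]
  exact List.map_congr_left fun e _ => Expr.eval_subst σ ρ e

theorem Expr.eval_rename {𝔄 : TermAlgebra.{u}} {X : Type v} {Y : Type w} (ι : X → Y)
    (ρ : Y → 𝔄.Val) (e : Expr 𝔄 X) : (e.rename ι).eval ρ = e.eval (fun x => ρ (ι x)) := by
  simp [Expr.rename, Expr.eval_subst, Expr.eval]

theorem Act.eval_rename {𝔄 : TermAlgebra.{u}} {X : Type v} {Y : Type w} (ι : X → Y)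
    (ρ : Y → 𝔄.Val) (α : Act 𝔄 X) : (α.rename ι).eval ρ = α.eval (fun x => ρ (ι x)) := by
  simp [Act.rename, Act.eval_subst, Expr.eval]

namespace OpenTransition

variable {𝔄 : TermAlgebra.{u}} {Idx : Type w} {Y : Type v} {S : Type z}

theorem subset_saturate (V : Set Y) (T : Set (OpenTransition 𝔄 Idx Y S)) : T ⊆ saturate V T := by
  intro t ht
  refine ⟨t, ht, Expr.var, fun _ => True, fun _ _ => rfl, ?_⟩
  simp [refine, funext Expr.subst_var, funext Act.subst_var, Expr.eval]

end OpenTransition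

namespace PNet

open OpenAutomaton

variable {𝔄 : TermAlgebra.{u}} {X Y : Type v} {Idx : Type w}

theorem mem_holes_of_mem_holeSort (P : PNet.{u, v, w, z} 𝔄 X Idx) :
    ∀ j a, a ∈ P.holeSort j → j ∈ P.holes := by
  induction P with
  | lts p => exact fun j a h => h.elim
  | node I J sub sort SV ih =>
    rintro j a (⟨h, -⟩ | ⟨i, h⟩)
    · exact Or.inl h
    · exact Or.inr (Set.mem_iUnion.2 ⟨i, ih i j a h⟩)

/-- Simulations between the sub-pNets of two nodes with the same holes and the same
synchronisation vectors give a simulation between the nodes. -/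
theorem fhSimulation_node {I J : Set Idx} {sub₁ sub₂ : I → PNet.{u, v, w, z} 𝔄 X Idx}
    {sort : J → Set (ActSig 𝔄)} {SV : Set (SyncVec 𝔄 X Idx)} {ι₁ ι₂ : X → Y}
    (inj₁ : ι₁.Injective) (inj₂ : ι₂.Injective) (hι : ∀ x x', ι₁ x ≠ ι₂ x')
    (vars₁ : ∀ i i', i ≠ i' → Disjoint (sub₁ i).vars (sub₁ i').vars)
    (vars₂ : ∀ i i', i ≠ i' → Disjoint (sub₂ i).vars (sub₂ i').vars)
    (holesJ : ∀ i, Disjoint (sub₂ i).holes J)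
    (holes₂ : ∀ i i', i ≠ i' → Disjoint (sub₂ i).holes (sub₂ i').holes)
    {R : ∀ i, (sub₁ i).State → (sub₂ i).State → (Y → 𝔄.Val) → Prop}
    (dep : ∀ i s s', DependsOn (R i s s') (ι₁ '' (sub₁ i).vars ∪ ι₂ '' (sub₂ i).vars))
    (sim : ∀ i, FHSimulation ((sub₁ i).automaton ι₁) ((sub₂ i).automaton ι₂) (R i)) :
    FHSimulation ((node I J sub₁ sort SV).automaton ι₁) ((node I J sub₂ sort SV).automaton ι₂)
      (fun s s' ρ => ∀ i, R i (proj s i) (proj s' i) ρ) := by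
  classical
  rintro s s' t ht rfl
  refine ⟨{t' | t' ∈ trans ι₂ (node I J sub₂ sort SV) ∧ t'.src = s' ∧
    ∀ j, (t'.hole j).isSome ↔ (t.hole j).isSome}, fun t' h => h.1, fun t' h => h.2, ?_⟩
  intro ρ hR hpred
  obtain ⟨t₀, ⟨sv, hsv, θ, o, b, ho, hidle, hb, hhole, hpr, hpost⟩, σ, φ, hσ, rfl⟩ := ht
  obtain ⟨hp, -⟩ := hpred
  obtain ⟨hop, hoa, hba, hglob, hguard⟩ := (hpr _).1 hp
  have step : ∀ i : I, ∃ o' : OpenTransition 𝔄 Idx Y (sub₂ i).State, sv.act i ≠ none →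
      o' ∈ trans ι₂ (sub₂ i) ∧ o'.src = proj s' i ∧
      (∀ j, (o'.hole j).isSome ↔ ((o i).hole j).isSome) ∧
      (∀ j β β', (o i).hole j = some β → o'.hole j = some β' →
        (β.subst σ).eval ρ = β'.eval ρ) ∧
      o'.pred ρ ∧ ((o i).act.subst σ).eval ρ = o'.act.eval ρ ∧
      R i (o i).tgt o'.tgt (update (fun y => ((o i).post y).map (Expr.subst σ)) o'.post ρ) := by
    intro i
    by_cases hi : sv.act i = none
    · exact ⟨⟨proj s' i, proj s' i, fun _ => none, t₀.act, fun _ => True, fun _ => none⟩,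
        fun h => (h hi).elim⟩
    · obtain ⟨hoT, hsrc, htgt⟩ := ho i hi
      have hmem : (o i).refine σ (fun _ => True) ∈ trans ι₁ (sub₁ i) := by
        refine trans_closed ι₁ (sub₁ i) _ hoT σ _ ?_
        rintro _ ⟨x, hx, rfl⟩
        exact hσ _ ⟨x, Set.mem_iUnion.2 ⟨i, hx⟩, rfl⟩
      obtain ⟨F, hF, hF', hcov⟩ := sim i (o i).src (proj s' i) _ hmem rfl
      obtain ⟨o', ho', h₁, h₂, h₃, h₄⟩ :=
        hcov ρ (by rw [hsrc]; exact hR i) ⟨hop i hi, trivial⟩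
      refine ⟨o', fun _ => ⟨hF ho', (hF' o' ho').1, fun j => ?_, fun j β β' hβ hβ' => ?_,
        h₂, h₃, h₄⟩⟩
      · rw [(hF' o' ho').2 j]
        simp [OpenTransition.refine]
      · exact h₁ j _ β' (by simp [OpenTransition.refine, hβ]) hβ'
  choose o' ho' using step
  have hole_uniq : ∀ i i' : I, sv.act i ≠ none → sv.act i' ≠ none → ∀ j β β',
      (o' i).hole j = some β → (o' i').hole j = some β' → i = i' := by
    intro i i' hi hi' j β β' hβ hβ'
    by_contra hne
    exact Set.disjoint_left.1 (holes₂ i i' hne) (trans_hole ι₂ _ _ (ho' i hi).1 j β hβ).1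
      (trans_hole ι₂ _ _ (ho' i' hi').1 j β' hβ').1
  have hole_J : ∀ i : I, sv.act i ≠ none → ∀ j ∈ J, ∀ β, (o' i).hole j ≠ some β := by
    intro i hi j hj β hβ
    exact Set.disjoint_left.1 (holesJ i) (trans_hole ι₂ _ _ (ho' i hi).1 j β hβ).1 hj
  obtain ⟨hole', hhole'⟩ := exists_option_fun
    (fun (j : Idx) (β : Act 𝔄 Y) =>
      (∃ h : j ∈ J, sv.act j ≠ none ∧ (b ⟨j, h⟩).subst σ = β) ∨
        (∃ i : I, sv.act i ≠ none ∧ (o' i).hole j = some β)) (by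
    rintro j β β' (⟨h, hv, rfl⟩ | ⟨i, hi, hβ⟩) (⟨h', hv', rfl⟩ | ⟨i', hi', hβ'⟩)
    · rfl
    · exact (hole_J i' hi' j h _ hβ').elim
    · exact (hole_J i hi j h' _ hβ).elim
    · obtain rfl := hole_uniq i i' hi hi' j _ _ hβ hβ'
      exact Option.some.inj (hβ.symm.trans hβ'))
  have post_uniq₁ : ∀ i i' : I, sv.act i' ≠ none → ∀ x ∈ (sub₁ i).vars, ∀ e,
      (o i').post (ι₁ x) = some e → i = i' := by
    intro i i' hi' x hx e he
    by_contra hne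
    obtain ⟨x', hx', e'⟩ := trans_post ι₁ _ _ (ho i' hi').1 _ e he
    obtain rfl := inj₁ e'
    exact Set.disjoint_left.1 (vars₁ i i' hne) hx hx'
  have post_uniq₂ : ∀ i i' : I, sv.act i' ≠ none → ∀ x ∈ (sub₂ i).vars, ∀ e,
      (o' i').post (ι₂ x) = some e → i = i' := by
    intro i i' hi' x hx e he
    by_contra hne
    obtain ⟨x', hx', e'⟩ := trans_post ι₂ _ _ (ho' i' hi').1 _ e he
    obtain rfl := inj₂ e'
    exact Set.disjoint_left.1 (vars₂ i i' hne) hx hx'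
  have post₁₂ : ∀ i : I, sv.act i ≠ none → ∀ x e, (o i).post (ι₂ x) ≠ some e := by
    intro i hi x e he
    obtain ⟨x', -, e'⟩ := trans_post ι₁ _ _ (ho i hi).1 _ e he
    exact hι x' x e'
  have post₂₁ : ∀ i : I, sv.act i ≠ none → ∀ x e, (o' i).post (ι₁ x) ≠ some e := by
    intro i hi x e he
    obtain ⟨x', -, e'⟩ := trans_post ι₂ _ _ (ho' i hi).1 _ e he
    exact hι x x' e'.symm
  obtain ⟨post', hpost'⟩ := exists_option_fun
    (fun (y : Y) (e : Expr 𝔄 Y) => ∃ i : I, sv.act i ≠ none ∧ (o' i).post y = some e) (by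
    rintro y e e' ⟨i, hi, he⟩ ⟨i', hi', he'⟩
    obtain ⟨x, hx, rfl⟩ := trans_post ι₂ _ _ (ho' i hi).1 _ e he
    obtain rfl := post_uniq₂ i i' hi' x hx e' he'
    exact Option.some.inj (he.symm.trans he'))
  let tgt' : (node I J sub₂ sort SV).State := fun l =>
    if sv.act l.1 = none then s' l else (o' l.1).tgt l.2
  have tgt_idle : ∀ i : I, sv.act i = none → proj tgt' i = proj s' i := by
    intro i hi
    funext l
    exact if_pos hi
  have tgt_move : ∀ i : I, sv.act i ≠ none → proj tgt' i = (o' i).tgt := by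
    intro i hi
    funext l
    exact if_neg hi
  let θ' : X → Expr 𝔄 Y := fun x => (θ x).subst σ
  have hθA : ∀ a : Act 𝔄 X, (a.subst θ').eval ρ =
      (a.subst θ).eval (fun y => (σ y).eval ρ) := by
    intro a
    simp [θ', Act.eval_subst, Expr.eval_subst]
  have hθE : ∀ e : Expr 𝔄 X, (e.subst θ').eval ρ =
      (e.subst θ).eval (fun y => (σ y).eval ρ) := by
    intro a
    simp [θ', Expr.eval_subst]
  let pred' : (Y → 𝔄.Val) → Prop := fun ρ =>
    (∀ i : I, sv.act i ≠ none → (o' i).pred ρ) ∧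
      (∀ (i : I) (a : Act 𝔄 X), sv.act i = some a → (o' i).act.eval ρ = (a.subst θ').eval ρ) ∧
      (∀ (j : J) (a : Act 𝔄 X), sv.act j = some a →
        ((b j).subst σ).eval ρ = (a.subst θ').eval ρ) ∧
      (t₀.act.subst σ).eval ρ = (sv.glob.subst θ').eval ρ ∧
      (sv.guard.subst θ').Holds ρ
  refine ⟨⟨s', tgt', hole', t₀.act.subst σ, pred', post'⟩, ⟨?_, rfl, ?_⟩, ?_, ?_, rfl, ?_⟩
  · refine OpenTransition.subset_saturate _ _ ⟨sv, hsv, θ', o', fun j => (b j).subst σ,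
      fun i hi => ⟨(ho' i hi).1, (ho' i hi).2.1, (tgt_move i hi).symm⟩, tgt_idle,
      fun j hj => ?_, hhole', fun _ => Iff.rfl, hpost'⟩
    rw [Act.sig_subst]
    exact hb j hj
  · intro j
    simp only [OpenTransition.refine, Option.isSome_map]
    rw [Option.isSome_iff_exists, Option.isSome_iff_exists]
    constructor
    · rintro ⟨β, hβ⟩
      rcases (hhole' j β).1 hβ with ⟨h, hv, -⟩ | ⟨i, hi, h⟩
      · exact ⟨_, (hhole j _).2 (Or.inl ⟨h, hv, rfl⟩)⟩
      · obtain ⟨β', h'⟩ := Option.isSome_iff_exists.1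
          (((ho' i hi).2.2.1 j).1 (Option.isSome_iff_exists.2 ⟨β, h⟩))
        exact ⟨β', (hhole j _).2 (Or.inr ⟨i, hi, h'⟩)⟩
    · rintro ⟨β, hβ⟩
      rcases (hhole j β).1 hβ with ⟨h, hv, -⟩ | ⟨i, hi, h⟩
      · exact ⟨_, (hhole' j _).2 (Or.inl ⟨h, hv, rfl⟩)⟩
      · obtain ⟨β', h'⟩ := Option.isSome_iff_exists.1
          (((ho' i hi).2.2.1 j).2 (Option.isSome_iff_exists.2 ⟨β, h⟩))
        exact ⟨β', (hhole' j _).2 (Or.inr ⟨i, hi, h'⟩)⟩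
  · intro j β β' hβ hβ'
    obtain ⟨β₀, h₀, rfl⟩ := Option.map_eq_some_iff.1 hβ
    have move : ∀ i : I, sv.act i ≠ none → (o i).hole j = some β₀ →
        ∃ β', (o' i).hole j = some β' := fun i hi h =>
      Option.isSome_iff_exists.1 (((ho' i hi).2.2.1 j).2 (Option.isSome_iff_exists.2 ⟨_, h⟩))
    rcases (hhole j β₀).1 h₀ with ⟨h, hv, rfl⟩ | ⟨i, hi, hi₀⟩ <;>
      rcases (hhole' j β').1 hβ' with ⟨h', hv', rfl⟩ | ⟨i', hi', hi₁⟩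
    · rfl
    · exact (hole_J i' hi' j h _ hi₁).elim
    · obtain ⟨β₁, h₁⟩ := move i hi hi₀
      exact (hole_J i hi j h' _ h₁).elim
    · obtain ⟨β₁, h₁⟩ := move i hi hi₀
      obtain rfl := hole_uniq i i' hi hi' j _ _ h₁ hi₁
      exact (ho' i hi).2.2.2.1 j β₀ β' hi₀ hi₁
  · refine ⟨fun i hi => (ho' i hi).2.2.2.2.1, fun i a ha => ?_, fun j a ha => ?_, ?_, ?_⟩
    · rw [hθA, ← hoa i a ha, ← Act.eval_subst]
      exact (ho' i (by simp [ha])).2.2.2.2.2.1.symm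
    · rw [hθA, ← hba j a ha, Act.eval_subst]
    · rw [hθA, ← hglob, Act.eval_subst]
    · unfold Expr.Holds
      rw [hθE]
      exact hguard
  · intro i
    change R i (proj t₀.tgt i) (proj tgt' i) _
    have no₁ : ∀ x, t₀.post (ι₂ x) = none := by
      refine fun x => Option.eq_none_iff_forall_ne_some.2 fun e he => ?_
      obtain ⟨i', hi', h⟩ := (hpost _ e).1 he
      exact post₁₂ i' hi' x e h
    have no₂ : ∀ x, post' (ι₁ x) = none := by
      refine fun x => Option.eq_none_iff_forall_ne_some.2 fun e he => ?_
      obtain ⟨i', hi', h⟩ := (hpost' _ e).1 he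
      exact post₂₁ i' hi' x e h
    by_cases hi : sv.act i = none
    · rw [hidle i hi, tgt_idle i hi]
      refine (dep i _ _ ?_).mp (hR i)
      have idle₁ : ∀ x ∈ (sub₁ i).vars, t₀.post (ι₁ x) = none := by
        refine fun x hx => Option.eq_none_iff_forall_ne_some.2 fun e he => ?_
        obtain ⟨i', hi', h⟩ := (hpost _ e).1 he
        obtain rfl := post_uniq₁ i i' hi' x hx e h
        exact hi' hi
      have idle₂ : ∀ x ∈ (sub₂ i).vars, post' (ι₂ x) = none := by
        refine fun x hx => Option.eq_none_iff_forall_ne_some.2 fun e he => ?_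
        obtain ⟨i', hi', h⟩ := (hpost' _ e).1 he
        obtain rfl := post_uniq₂ i i' hi' x hx e h
        exact hi' hi
      rintro _ (⟨x, hx, rfl⟩ | ⟨x, hx, rfl⟩)
      · simp [update, OpenTransition.refine, idle₁ x hx, no₂ x, Expr.eval]
      · simp [update, OpenTransition.refine, idle₂ x hx, no₁ x, Expr.eval]
    · rw [tgt_move i hi, ← (ho i hi).2.2]
      refine (dep i _ _ ?_).mp (ho' i hi).2.2.2.2.2.2
      have move₁ : ∀ x ∈ (sub₁ i).vars, t₀.post (ι₁ x) = (o i).post (ι₁ x) := by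
        refine fun x hx => Option.ext fun e => ?_
        rw [hpost]
        refine ⟨?_, fun h => ⟨i, hi, h⟩⟩
        rintro ⟨i', hi', h⟩
        obtain rfl := post_uniq₁ i i' hi' x hx e h
        exact h
      have move₂ : ∀ x ∈ (sub₂ i).vars, post' (ι₂ x) = (o' i).post (ι₂ x) := by
        refine fun x hx => Option.ext fun e => ?_
        rw [hpost']
        refine ⟨?_, fun h => ⟨i, hi, h⟩⟩
        rintro ⟨i', hi', h⟩
        obtain rfl := post_uniq₂ i i' hi' x hx e h
        exact h
      rintro _ (⟨x, hx, rfl⟩ | ⟨x, hx, rfl⟩)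
      · simp [update, OpenTransition.refine, move₁ x hx, no₂ x,
          Option.eq_none_iff_forall_ne_some.2 (post₂₁ i hi x)]
      · simp [update, OpenTransition.refine, move₂ x hx, no₁ x,
          Option.eq_none_iff_forall_ne_some.2 (post₁₂ i hi x)]

/-- Strong FH-bisimilarity is a congruence for nodes. -/
theorem FHBisimilar.node {I J : Set Idx} {sub₁ sub₂ : I → PNet.{u, v, w, z} 𝔄 X Idx}
    {sort : J → Set (ActSig 𝔄)} {SV : Set (SyncVec 𝔄 X Idx)} (η : X → 𝔄.Val)
    (vars₁ : ∀ i i', i ≠ i' → Disjoint (sub₁ i).vars (sub₁ i').vars)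
    (vars₂ : ∀ i i', i ≠ i' → Disjoint (sub₂ i).vars (sub₂ i').vars)
    (holesJ : ∀ i, Disjoint (sub₁ i).holes J)
    (holes : ∀ i i', i ≠ i' → Disjoint (sub₁ i).holes (sub₁ i').holes)
    (h : ∀ i, FHBisimilar (sub₁ i) (sub₂ i)) :
    FHBisimilar (node I J sub₁ sort SV) (node I J sub₂ sort SV) := by
  classical
  choose R hR ρ h₁ h₂ h₀ using h
  have same : ∀ i, (sub₁ i).holes = (sub₂ i).holes := fun i => (hR i).same_holes
  have hsort : ∀ i j, (sub₁ i).holeSort j = (sub₂ i).holeSort j := by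
    intro i j
    by_cases hj : j ∈ (sub₁ i).holes
    · exact (hR i).same_sorts j hj
    · ext a
      exact ⟨fun ha => (hj (mem_holes_of_mem_holeSort _ j a ha)).elim, fun ha =>
        (hj (same i ▸ mem_holes_of_mem_holeSort _ j a ha)).elim⟩
  refine ⟨fun s s' ρ => ∀ i, R i (proj s i) (proj s' i) ρ, ⟨?_, ?_, ?_, ?_, ?_, ?_⟩, ?_⟩
  · change J ∪ ⋃ i, (sub₁ i).holes = J ∪ ⋃ i, (sub₂ i).holes
    simp only [same]
  · intro j _
    change {a | _ ∨ ∃ i, a ∈ (sub₁ i).holeSort j} = {a | _ ∨ ∃ i, a ∈ (sub₂ i).holeSort j}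
    simp only [hsort]
  · refine Set.disjoint_left.2 ?_
    rintro _ ⟨x, -, rfl⟩ ⟨x', -, h⟩
    simp at h
  · intro s s' ρ₁ ρ₂ hρ
    refine forall_congr fun i => (hR i).over_vars _ _ fun y hy => hρ y ?_
    rcases hy with ⟨x, hx, rfl⟩ | ⟨x, hx, rfl⟩
    · exact Or.inl ⟨x, Set.mem_iUnion.2 ⟨i, hx⟩, rfl⟩
    · exact Or.inr ⟨x, Set.mem_iUnion.2 ⟨i, hx⟩, rfl⟩
  · exact fhSimulation_node Sum.inl_injective Sum.inr_injective (by simp) vars₁ vars₂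
      (fun i => same i ▸ holesJ i) (fun i i' hne => same i ▸ same i' ▸ holes i i' hne)
      (fun i => (hR i).over_vars) (fun i => (hR i).forth)
  · exact fhSimulation_node (R := fun i s' s => R i s s') Sum.inr_injective Sum.inl_injective
      (by simp) vars₂ vars₁ holesJ holes
      (fun i s' s => by rw [Set.union_comm]; exact (hR i).over_vars s s')
      (fun i => (hR i).back)
  · let ρ' : X ⊕ X → 𝔄.Val := Sum.elim
      (fun x => if h : ∃ i, x ∈ (sub₁ i).vars then ρ h.choose (Sum.inl x) else η x)
      (fun x => if h : ∃ i, x ∈ (sub₂ i).vars then ρ h.choose (Sum.inr x) else η x)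
    have e₁ : ∀ i, ∀ x ∈ (sub₁ i).vars, ρ' (Sum.inl x) = ρ i (Sum.inl x) := by
      intro i x hx
      have hex : ∃ i, x ∈ (sub₁ i).vars := ⟨i, hx⟩
      have : hex.choose = i := by
        by_contra hne
        exact Set.disjoint_left.1 (vars₁ _ _ hne) hex.choose_spec hx
      simp only [ρ', Sum.elim_inl, dif_pos hex, this]
    have e₂ : ∀ i, ∀ x ∈ (sub₂ i).vars, ρ' (Sum.inr x) = ρ i (Sum.inr x) := by
      intro i x hx
      have hex : ∃ i, x ∈ (sub₂ i).vars := ⟨i, hx⟩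
      have : hex.choose = i := by
        by_contra hne
        exact Set.disjoint_left.1 (vars₂ _ _ hne) hex.choose_spec hx
      simp only [ρ', Sum.elim_inr, dif_pos hex, this]
    have leaf_vars : ∀ (P : PNet.{u, v, w, z} 𝔄 X Idx) (l : P.Leaves), (P.leaf l).V ⊆ P.vars := by
      intro P
      induction P with
      | lts p => exact fun l => subset_rfl
      | node I J sub sort SV ih =>
        exact fun l x hx => Set.mem_iUnion.2 ⟨l.1, ih l.1 l.2 hx⟩
    refine ⟨ρ', ?_, ?_, fun i => ?_⟩
    · rintro _ a ⟨⟨i, l⟩, x, hx, rfl, ha⟩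
      rw [e₁ i x (leaf_vars (sub₁ i) l hx)]
      exact h₁ i _ a ⟨l, x, hx, rfl, ha⟩
    · rintro _ a ⟨⟨i, l⟩, x, hx, rfl, ha⟩
      rw [e₂ i x (leaf_vars (sub₂ i) l hx)]
      exact h₂ i _ a ⟨l, x, hx, rfl, ha⟩
    · refine ((hR i).over_vars _ _ ?_).mp (h₀ i)
      rintro _ (⟨x, hx, rfl⟩ | ⟨x, hx, rfl⟩)
      · exact (e₁ i x hx).symm
      · exact (e₂ i x hx).symm

/-- Two copies of a pLTS simulate each other as long as their variables have the same values. -/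
theorem fhSimulation_lts (p : PLTS.{u, v, z} 𝔄 X) {ι₁ ι₂ : X → Y}
    (inj₁ : ι₁.Injective) (inj₂ : ι₂.Injective) (hι : ∀ x x', ι₁ x ≠ ι₂ x') :
    FHSimulation ((lts p : PNet.{u, v, w, z} 𝔄 X Idx).automaton ι₁)
      ((lts p : PNet.{u, v, w, z} 𝔄 X Idx).automaton ι₂)
      (fun s s' ρ => s = s' ∧ ∀ x ∈ p.V, ρ (ι₁ x) = ρ (ι₂ x)) := by
  classical
  rintro s s' t ht rfl
  refine ⟨{t' | t' ∈ trans ι₂ (lts p : PNet.{u, v, w, z} 𝔄 X Idx) ∧ t'.src = s' ∧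
    ∀ j, (t'.hole j).isSome ↔ (t.hole j).isSome}, fun t' h => h.1, fun t' h => h.2, ?_⟩
  rintro ρ ⟨hs, hV⟩ hpred
  obtain ⟨t₀, ⟨s, α, g, asg, r, htr, hsrc, htgt, hhole, hact, hpr, hpost⟩, σ, φ, hσ, rfl⟩ := ht
  have hp : (g.rename ι₁).Holds (fun y => (σ y).eval ρ) := hpr ▸ hpred.1
  let σ' : Y → Expr 𝔄 Y :=
    Function.extend ι₂ (fun x => if x ∈ p.V then Expr.var (ι₂ x) else σ (ι₁ x)) Expr.var
  let post' : Y → Option (Expr 𝔄 Y) :=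
    Function.extend ι₂ (fun x => (asg x).map (Expr.rename ι₂)) (fun _ => none)
  have hpost₁ : ∀ x, t₀.post (ι₁ x) = (asg x).map (Expr.rename ι₁) := by
    intro x
    ext e
    rw [hpost, Option.map_eq_some_iff]
    exact ⟨fun ⟨x', e₀, hx, h⟩ => ⟨e₀, inj₁ hx ▸ h⟩, fun ⟨e₀, h⟩ => ⟨x, e₀, rfl, h⟩⟩
  have hpost₁₂ : ∀ x, t₀.post (ι₂ x) = none := by
    refine fun x => Option.eq_none_iff_forall_ne_some.2 fun e he => ?_
    obtain ⟨x', -, hx, -⟩ := (hpost _ e).1 he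
    exact hι x' x hx
  have hpost₂ : ∀ x, post' (ι₂ x) = (asg x).map (Expr.rename ι₂) := inj₂.extend_apply _ _
  have hpost₂₁ : ∀ x, post' (ι₁ x) = none := fun x =>
    Function.extend_apply' _ _ _ fun ⟨x', hx⟩ => hι x x' hx.symm
  have hσ' : ∀ x, (σ' (ι₂ x)).eval ρ = (σ (ι₁ x)).eval ρ := by
    intro x
    simp only [σ', inj₂.extend_apply]
    split_ifs with hx
    · rw [hσ _ ⟨x, hx, rfl⟩]
      exact (hV x hx).symm
    · rfl
  let t₁ : OpenTransition 𝔄 Idx Y (lts p : PNet.{u, v, w, z} 𝔄 X Idx).State :=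
    ⟨fun _ => s, fun _ => r, fun _ => none, α.toAct.rename ι₂, (g.rename ι₂).Holds, post'⟩
  refine ⟨t₁.refine σ' (fun _ => True), ⟨⟨t₁, ⟨s, α, g, asg, r, htr, rfl, rfl, fun _ => rfl, rfl,
    rfl, fun y e => ?_⟩, σ', _, ?_, rfl⟩, ?_, ?_⟩, ?_, ⟨?_, trivial⟩, ?_, ?_, ?_⟩
  · constructor
    · intro he
      by_cases hy : ∃ x, ι₂ x = y
      · obtain ⟨x, rfl⟩ := hy
        obtain ⟨e₀, h⟩ := Option.map_eq_some_iff.1 ((hpost₂ x).symm.trans he)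
        exact ⟨x, e₀, rfl, h⟩
      · have : post' y = none := Function.extend_apply' _ _ _ hy
        simp [t₁, this] at he
    · rintro ⟨x, e₀, rfl, h, rfl⟩
      exact (hpost₂ x).trans (by rw [h]; rfl)
  · rintro _ ⟨x, hx, rfl⟩
    simp only [σ', inj₂.extend_apply, hx, if_true]
  · exact hsrc.symm.trans hs
  · intro j
    simp [t₁, OpenTransition.refine, hhole]
  · intro j β β' hβ
    simp [OpenTransition.refine, hhole] at hβ
  · change (g.rename ι₂).Holds _
    unfold Expr.Holds at hp ⊢
    rw [Expr.eval_rename] at hp ⊢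
    simpa only [hσ'] using hp
  · simp only [OpenTransition.refine, hact, t₁, Act.eval_subst, Act.eval_rename, hσ']
  · exact htgt
  · intro x hx
    simp only [update, OpenTransition.refine, t₁, hpost₁, hpost₁₂, hpost₂, hpost₂₁]
    cases asg x with
    | none => simpa [Expr.eval] using hV x hx
    | some e => simp [Expr.eval_subst, Expr.eval_rename, hσ']

theorem FHBisimilar.refl (η : X → 𝔄.Val) (P : PNet.{u, v, w, z} 𝔄 X Idx) (wf : P.WF) :
    FHBisimilar P P := by
  induction P with
  | lts p =>
    refine ⟨fun s s' ρ => s = s' ∧ ∀ x ∈ p.V, ρ (Sum.inl x) = ρ (Sum.inr x),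
      ⟨rfl, fun _ _ => rfl, ?_, ?_, fhSimulation_lts p Sum.inl_injective Sum.inr_injective
        (by simp), ?_⟩, Sum.elim (fun x => (p.init x).getD (η x)) (fun x => (p.init x).getD (η x)),
        ?_, ?_, rfl, fun _ _ => rfl⟩
    · refine Set.disjoint_left.2 ?_
      rintro _ ⟨x, -, rfl⟩ ⟨x', -, h⟩
      simp at h
    · intro s s' ρ₁ ρ₂ hρ
      refine congrArg _ (propext (forall₂_congr fun x hx => ?_))
      rw [hρ _ (Or.inl ⟨x, hx, rfl⟩), hρ _ (Or.inr ⟨x, hx, rfl⟩)]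
    · convert fhSimulation_lts (Idx := Idx) p (Sum.inr_injective (α := X) (β := X))
        Sum.inl_injective (by simp) using 5
      · exact eq_comm
      · exact forall₂_congr fun x _ => eq_comm
    · rintro _ a ⟨_, x, _, rfl, ha⟩
      change p.init x = some a at ha
      simp [ha]
    · rintro _ a ⟨_, x, _, rfl, ha⟩
      change p.init x = some a at ha
      simp [ha]
  | node I J sub sort SV ih =>
    obtain ⟨h, -, -, hv, hJ, hh, -⟩ := wf
    exact FHBisimilar.node η hv hv hJ hh fun i => ih i (h i)

end PNet

theorem mainTheorem1 {𝔄 : TermAlgebra.{u}} {X : Type v} {Idx : Type w}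
    (I J : Set Idx) (sub : I → PNet.{u, v, w, z} 𝔄 X Idx) (sort : J → Set (ActSig 𝔄))
    (SV : Set (SyncVec 𝔄 X Idx)) (P Q Q' : PNet.{u, v, w, z} 𝔄 X Idx)
    (hP : P = PNet.node I J sub sort SV) (j₀ : J)
    (wfP : P.WF) (wfQ : Q.WF) (wfQ' : Q'.WF)
    (varsQ : Disjoint P.vars Q.vars) (varsQ' : Disjoint P.vars Q'.vars)
    (holesQ : Disjoint (P.holes \ {j₀.1}) Q.holes)
    (holesQ' : Disjoint (P.holes \ {j₀.1}) Q'.holes)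
    (sortQ : Q.outSort = sort j₀) (sortQ' : Q'.outSort = sort j₀)
    (hQQ' : PNet.FHBisimilar Q Q') :
    PNet.FHBisimilar (P.fill j₀ Q) (P.fill j₀ Q') := by
  classical
  subst hP
  obtain ⟨wf, -, -, hv, hJ, hh, -⟩ := wfP
  obtain ⟨-, -, ρ, -⟩ := id hQQ'
  have eq_j₀ : ∀ i : ↑(insert j₀.1 I), i.1 ∉ I → i.1 = j₀.1 := fun i hi => i.2.resolve_right hi
  have disj_vars : ∀ N : PNet.{u, v, w, z} 𝔄 X Idx,
      Disjoint (PNet.node I J sub sort SV).vars N.vars → ∀ i i' : ↑(insert j₀.1 I), i ≠ i' →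
      Disjoint (if h : i.1 ∈ I then sub ⟨i.1, h⟩ else N).vars
        (if h : i'.1 ∈ I then sub ⟨i'.1, h⟩ else N).vars := by
    intro N hN i i' hne
    have hsub : ∀ i, Disjoint (sub i).vars N.vars := fun i =>
      hN.mono_left (Set.subset_iUnion (fun i => (sub i).vars) i)
    split_ifs with h h' h'
    · exact hv _ _ fun e => hne (Subtype.ext (Subtype.mk.inj e))
    · exact hsub _
    · exact (hsub _).symm
    · exact (hne (Subtype.ext ((eq_j₀ i h).trans (eq_j₀ i' h').symm))).elim
  have holes_sub : ∀ i, Disjoint (sub i).holes Q.holes := by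
    refine fun i => Set.disjoint_left.2 fun j hj =>
      Set.disjoint_left.1 holesQ ⟨Or.inr (Set.mem_iUnion.2 ⟨i, hj⟩), ?_⟩
    rintro rfl
    exact Set.disjoint_left.1 (hJ i) hj j₀.2
  refine PNet.FHBisimilar.node (fun x => ρ (Sum.inl x)) (disj_vars Q varsQ) (disj_vars Q' varsQ')
    (fun i => ?_) (fun i i' hne => ?_) (fun i => ?_)
  · split_ifs with h
    · exact (hJ _).mono_right Set.sdiff_subset
    · exact (holesQ.mono_left (Set.sdiff_subset_sdiff_left Set.subset_union_left)).symm
  · split_ifs with h h' h'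
    · exact hh _ _ fun e => hne (Subtype.ext (Subtype.mk.inj e))
    · exact holes_sub _
    · exact (holes_sub _).symm
    · exact (hne (Subtype.ext ((eq_j₀ i h).trans (eq_j₀ i' h').symm))).elim
  · split_ifs with h
    · exact PNet.FHBisimilar.refl (fun x => ρ (Sum.inl x)) _ (wf _)
    · exact hQQ'
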